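/- Let $X$ be a separable metrizable space, and let $C_p(X)$ be the set of continuous functions $X\to\mathbb R$ with the topology of pointwise convergence. For a set $S$ and families $\mathcal A,\mathcal B$ of subsets of $S$, in the game $G_{fin}(\mathcal A,\mathcal B)$ player ONE chooses $A_n\in\mathcal A$ in each round $n<\omega$, and TWO responds with a finite set $B_n\subseteq A_n$; TWO wins if $\bigcup_{n}B_n\in\mathcal B$. Write $\mathrm{TWO}\uparrow G_{fin}(\mathcal A,\mathcal B)$ if TWO has a winning strategy choosing $B_n$ as a function of $(A_0,\dots,A_n)$, and $\mathrm{TWO}\uparrow_{mark} G_{fin}(\mathcal A,\mathcal B)$ if TWO has a winning Markov strategy, choosing $B_n$ as a function of $A_n$ and $n$ only. Let $\mathcal D$ be the family of dense subsets of $C_p(X)$; for $f\in C_p(X)$ let $\Omega_f=\{A\subseteq C_p(X): f\in\overline A\setminus A \text{ or } A=\{f\}\}$; and let $\Omega$ be the family of open $\omega$-covers of $X$, that is, of those families $\mathcal U$ of open subsets of $X$ with $\bigcup\mathcal U=X$ and $X\notin\mathcal U$ such that every finite subset of $X$ is contained in a member of $\mathcal U$. Then the following are equivalent: 1. $\mathrm{TWO}\uparrow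 G_{fin}(\mathcal D,\mathcal D)$ on $C_p(X)$; 2. $\mathrm{TWO}\uparrow G_{fin}(\mathcal D,\Omega_f)$ on $C_p(X)$ for every $f\in C_p(X)$; 3. $\mathrm{TWO}\uparrow G_{fin}(\Omega,\Omega)$ on $X$; 4. $\mathrm{TWO}\uparrow_{mark} G_{fin}(\mathcal D,\mathcal D)$ on $C_p(X)$; 5. $\mathrm{TWO}\uparrow_{mark} G_{fin}(\mathcal D,\Omega_f)$ on $C_p(X)$ for every $f\in C_p(X)$; 6. $\mathrm{TWO}\uparrow_{mark} G_{fin}(\Omega,\Omega)$ on $X$; 7. $X$ is $\sigma$-compact. -/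

import Mathlib

/-!
Finite-selection games, the families `𝒟`, `Ω_x`, `Ω`, and the space `C_p(X)`.
-/

namespace SelectionGame

/-- `TWO ↑ G_fin(𝒜, ℬ)`. In round `n` player ONE picks `A n ∈ 𝒜` and TWO answers with a finite
subset of `A n`; TWO wins when the union of all the answers belongs to `ℬ`. A (perfect
information) strategy `σ` reads all moves `A 0, …, A n` made by ONE so far. -/
def TwoWins {α : Type*} (𝒜 ℬ : Set (Set α)) : Prop :=
  ∃ σ : (n : ℕ) → (Fin (n + 1) → Set α) → Finset α,
    (∀ (n : ℕ) (A : Fin (n + 1) → Set α), (∀ i, A i ∈ 𝒜) → (σ n A : Set α) ⊆ A (Fin.last n)) ∧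
    ∀ A : ℕ → Set α, (∀ n, A n ∈ 𝒜) →
      (⋃ n : ℕ, (σ n (fun i : Fin (n + 1) => A i) : Set α)) ∈ ℬ

/-- `TWO ↑ G_fin(𝒜, ℬ)` by a Markov strategy: `σ` reads only the last move of ONE and the number
of the current round. -/
def TwoWinsMarkov {α : Type*} (𝒜 ℬ : Set (Set α)) : Prop :=
  ∃ σ : Set α → ℕ → Finset α,
    (∀ A ∈ 𝒜, ∀ n : ℕ, (σ A n : Set α) ⊆ A) ∧
    ∀ A : ℕ → Set α, (∀ n, A n ∈ 𝒜) → (⋃ n : ℕ, (σ (A n) n : Set α)) ∈ ℬ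

/-- `𝒟`: the dense subsets of a space. -/
def denseSets (Y : Type*) [TopologicalSpace Y] : Set (Set Y) :=
  {A | Dense A}

/-- `Ω_y`: the sets `A` with `y ∈ closure A \ A`, together with the set `{y}`. -/
def omegaAt {Y : Type*} [TopologicalSpace Y] (y : Y) : Set (Set Y) :=
  {A | y ∈ closure A \ A ∨ A = {y}}

/-- `Ω`: the open `ω`-covers of a space. Covers are nontrivial: the whole space is not a member. -/
def omegaCovers (X : Type*) [TopologicalSpace X] : Set (Set (Set X)) :=
  {𝒰 | (∀ U ∈ 𝒰, IsOpen U) ∧ ⋃₀ 𝒰 = Set.univ ∧ Set.univ ∉ 𝒰 ∧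
    ∀ F : Set X, F.Finite → ∃ U ∈ 𝒰, F ⊆ U}

/-- `C_p(X)`: the continuous real functions on `X` with the topology of pointwise convergence,
that is, as a subspace of the product `X → ℝ`. -/
abbrev Cp (X : Type*) [TopologicalSpace X] : Type _ :=
  {f : X → ℝ // Continuous f}

end SelectionGame

open Filter Topology

namespace SelectionGame

/-! ### Markov strategies and the topology of `C_p(X)` -/

/-! If `X` is σ-compact, compactness of `K ^ n` lets finitely many members of an ω-cover capture all
sets of at most `n` points of a compact `K`; using the `n`-th compact set in round `n` gives Markov
strategies, both on `X` and on `C_p(X)` (`IsCompact.exists_finset_omega_subfamily`). Conversely,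
`dense_oneOff` turns ω-covers into dense sets, so strategies on `C_p(X)` give one on ω-covers. At
each position, intersect over ONE's next moves the closures of the union of TWO's answer: this is
compact (`isCompact_iInter_closure_sUnion`) and, by second countability, already determined by
countably many moves. The resulting tree of positions is countable, and its compact sets cover `X`:
a missed point would let ONE play so that TWO never covers it. -/

theorem TwoWinsMarkov.twoWins {α : Type*} {𝒜 ℬ : Set (Set α)} (h : TwoWinsMarkov 𝒜 ℬ) :
    TwoWins 𝒜 ℬ := by
  obtain ⟨σ, hσ, hwin⟩ := h
  exact ⟨fun n A => σ (A (Fin.last n)) n, fun n A hA => hσ _ (hA _) n, fun A hA => hwin A hA⟩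

section Cp

variable {X : Type*} [TopologicalSpace X]

theorem mem_closure_Cp_iff {A : Set (Cp X)} {g : Cp X} :
    g ∈ closure A ↔ ∀ (F : Finset X) (ε : ℝ), 0 < ε →
      ∃ f ∈ A, ∀ x ∈ F, |f.1 x - g.1 x| < ε := by
  constructor
  · intro h F ε hε
    have hev : ∀ x : X, Continuous fun f : Cp X => f.1 x := fun x =>
      (continuous_apply x).comp continuous_subtype_val
    have ho : IsOpen {f : Cp X | ∀ x ∈ F, |f.1 x - g.1 x| < ε} := by
      have : {f : Cp X | ∀ x ∈ F, |f.1 x - g.1 x| < ε} =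
          ⋂ x ∈ F, {f : Cp X | |f.1 x - g.1 x| < ε} := by
        ext f
        simp
      rw [this]
      exact isOpen_biInter_finset fun x _ =>
        isOpen_lt ((hev x).sub continuous_const).abs continuous_const
    obtain ⟨f, hf, hfA⟩ := mem_closure_iff.1 h _ ho (fun x _ => by simpa using hε)
    exact ⟨f, hfA, hf⟩
  · intro h
    rw [mem_closure_iff]
    intro o ho hgo
    obtain ⟨s, hs, rfl⟩ := isOpen_induced_iff.1 ho
    obtain ⟨I, u, hu, hIu⟩ := isOpen_pi_iff.1 hs g.1 hgo
    have hev : ∀ᶠ ε in 𝓝[>] (0 : ℝ), ∀ x ∈ I, Metric.ball (g.1 x) ε ⊆ u x := by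
      rw [Filter.eventually_all_finset]
      intro x hx
      obtain ⟨δ, hδ, hball⟩ := Metric.isOpen_iff.1 (hu x hx).1 _ (hu x hx).2
      filter_upwards [Ioo_mem_nhdsGT hδ] with ε hε
      exact (Metric.ball_subset_ball hε.2.le).trans hball
    obtain ⟨ε, hball, hε⟩ := (hev.and self_mem_nhdsWithin).exists
    obtain ⟨f, hfA, hf⟩ := h I ε hε
    refine ⟨f, hIu fun x hx => hball x hx ?_, hfA⟩
    rw [Metric.mem_ball, Real.dist_eq]
    exact hf x hx

instance nhdsNE_neBot_Cp [Nonempty X] (f : Cp X) : (𝓝[≠] f).NeBot := by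
  rw [← mem_closure_iff_nhdsWithin_neBot, mem_closure_Cp_iff]
  intro F ε hε
  refine ⟨⟨fun x => f.1 x + ε / 2, f.2.add continuous_const⟩, ?_, fun x _ => ?_⟩
  · intro h
    obtain ⟨x⟩ := ‹Nonempty X›
    have := congrFun (congrArg Subtype.val h) x
    simp only at this
    linarith
  · rw [add_sub_cancel_left, abs_of_pos (half_pos hε)]
    exact half_lt_self hε

theorem dense_diff_singleton_Cp [Nonempty X] {A : Set (Cp X)} (hA : Dense A) (f : Cp X) :
    Dense (A \ {f}) :=
  hA.sdiff_singleton f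

theorem mem_omegaAt_of_dense_of_isEmpty [IsEmpty X] {A : Set (Cp X)} (hA : A.Nonempty)
    (f : Cp X) : A ∈ omegaAt f := by
  have : Subsingleton (Cp X) := ⟨fun a b => Subtype.ext (funext fun x => isEmptyElim x)⟩
  obtain ⟨a, ha⟩ := hA
  obtain rfl := Subsingleton.elim a f
  exact Or.inr (Set.eq_singleton_iff_unique_mem.2 ⟨ha, fun b _ => Subsingleton.elim b a⟩)

/-- Urysohn functions for pairs of basic open sets with `closure U ⊆ V` suffice. -/
theorem exists_countable_bump [NormalSpace X] [T1Space X] [SecondCountableTopology X] :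
    ∃ P : Set C(X, ℝ), P.Countable ∧ ∀ (F : Finset X), ∀ x ∉ F,
      ∃ φ ∈ P, φ x = 1 ∧ ∀ y ∈ F, φ y = 0 := by
  let ℬ := TopologicalSpace.countableBasis X
  have hℬ : TopologicalSpace.IsTopologicalBasis ℬ :=
    TopologicalSpace.isBasis_countableBasis X
  have key : ∀ p : ℬ × ℬ, ∃ φ : C(X, ℝ), closure (p.1 : Set X) ⊆ p.2 →
      (∀ x ∈ closure (p.1 : Set X), φ x = 1) ∧ ∀ x ∉ (p.2 : Set X), φ x = 0 := by
    rintro ⟨U, V⟩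
    by_cases h : closure (U : Set X) ⊆ V
    · obtain ⟨φ, h0, h1, -⟩ := exists_continuous_zero_one_of_isClosed
        (hℬ.isOpen V.2).isClosed_compl isClosed_closure (Set.disjoint_compl_left_iff_subset.2 h)
      exact ⟨φ, fun _ => ⟨fun x hx => h1 hx, fun x hx => h0 hx⟩⟩
    · exact ⟨0, fun h' => absurd h' h⟩
  choose φ hφ using key
  have : Countable ℬ := (TopologicalSpace.countable_countableBasis X).to_subtype
  refine ⟨Set.range φ, Set.countable_range φ, fun F x hx => ?_⟩
  obtain ⟨V, hV, hxV, hVF⟩ := hℬ.exists_subset_of_mem_open (a := x) (u := (F : Set X)ᶜ) hx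
    F.finite_toSet.isClosed.isOpen_compl
  obtain ⟨U, hU, hxU, hUV⟩ := hℬ.exists_closure_subset ((hℬ.isOpen hV).mem_nhds hxV)
  obtain ⟨h1, h0⟩ := hφ ⟨⟨U, hU⟩, ⟨V, hV⟩⟩ hUV
  exact ⟨_, ⟨_, rfl⟩, h1 x (subset_closure hxU), fun y hy => h0 y fun hyV => hVF hyV hy⟩

theorem separableSpace_Cp [NormalSpace X] [T1Space X] [SecondCountableTopology X] :
    TopologicalSpace.SeparableSpace (Cp X) := by
  classical
  obtain ⟨P, hP, hbump⟩ := exists_countable_bump (X := X)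
  have : Countable P := hP.to_subtype
  let s : Finset (ℚ × P) → Cp X := fun S =>
    ⟨fun x => ∑ p ∈ S, (p.1 : ℝ) * p.2.1 x,
      continuous_finsetSum _ fun p _ => continuous_const.mul p.2.1.continuous⟩
  refine ⟨Set.range s, Set.countable_range s, fun g => mem_closure_Cp_iff.2 fun F ε hε => ?_⟩
  choose φ hφP hφ1 hφ0 using fun x : X => hbump (F.erase x) x (Finset.notMem_erase x F)
  choose q hq using fun x : X => exists_rat_btwn (show g.1 x - ε < g.1 x + ε by linarith)
  let p : X → ℚ × P := fun x => (q x, ⟨φ x, hφP x⟩)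
  -- Injectivity keeps the image finset from merging terms: `φ x` vanishes at `y`, while `φ y` is
  -- `1` there.
  have hp : Set.InjOn p F := by
    intro x hx y hy hxy
    by_contra hne
    have hφxy : φ x = φ y := congrArg (fun z : ℚ × P => z.2.1) hxy
    have h0 := hφ0 x y (Finset.mem_erase.2 ⟨Ne.symm hne, hy⟩)
    rw [hφxy, hφ1 y] at h0
    exact one_ne_zero h0
  refine ⟨s (F.image p), ⟨_, rfl⟩, fun y hy => ?_⟩
  have hval : (s (F.image p)).1 y = q y := by
    change ∑ r ∈ F.image p, (r.1 : ℝ) * r.2.1 y = q y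
    rw [Finset.sum_image hp, Finset.sum_eq_single_of_mem y hy]
    · simp [p, hφ1 y]
    · intro x _ hxy
      simp [p, hφ0 x y (Finset.mem_erase.2 ⟨Ne.symm hxy, hy⟩)]
  rw [hval, abs_lt]
  constructor <;> linarith [(hq y).1, (hq y).2]

end Cp

/-! ### Finite selections from `ω`-covers of a `σ`-compact space -/

section SigmaCompact

theorem exists_fin_range_eq {β : Type*} {F : Finset β} (hF : F.Nonempty) {n : ℕ} (hn : F.card ≤ n) :
    ∃ x : Fin n → β, Set.range x = F := by
  obtain ⟨y, hy⟩ := hF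
  refine ⟨fun i => if h : (i : ℕ) < F.card then F.equivFin.symm ⟨i, h⟩ else y, ?_⟩
  ext z
  constructor
  · rintro ⟨i, rfl⟩
    dsimp only
    split_ifs with h
    · exact (F.equivFin.symm ⟨i, h⟩).2
    · exact hy
  · intro hz
    refine ⟨⟨F.equivFin ⟨z, hz⟩, (F.equivFin ⟨z, hz⟩).2.trans_le hn⟩, ?_⟩
    simp

variable {X : Type*} [TopologicalSpace X] {α : Type*}

/-- The boxes `V a ^ n` cover the compact power `K ^ n`; tuples with repetitions enumerate the
smaller sets. -/
theorem IsCompact.exists_finset_omega_subfamily {K : Set X} (hK : IsCompact K) (n : ℕ)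
    {V : α → Set X} (hV : ∀ a, IsOpen (V a)) {A : Set α}
    (hA : ∀ F : Finset X, ∃ a ∈ A, (F : Set X) ⊆ V a) :
    ∃ B : Finset α, (B : Set α) ⊆ A ∧
      ∀ F : Finset X, F.card ≤ n → (F : Set X) ⊆ K → ∃ a ∈ B, (F : Set X) ⊆ V a := by
  classical
  obtain ⟨a₀, ha₀, -⟩ := hA ∅
  have hpi : IsCompact (Set.univ.pi fun _ : Fin n => K) := isCompact_univ_pi fun _ => hK
  obtain ⟨T, hTA, hTfin, hT⟩ := hpi.elim_finite_subcover_image (b := A)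
    (c := fun a => Set.univ.pi fun _ : Fin n => V a)
    (fun a _ => isOpen_set_pi Set.finite_univ fun _ _ => hV a)
    (fun x _ => by
      obtain ⟨a, ha, hsub⟩ := hA (Finset.univ.image x)
      refine Set.mem_iUnion₂.2 ⟨a, ha, fun i _ => hsub ?_⟩
      simp)
  -- `a₀` serves `F = ∅`, since the subcover may be empty when `K` is.
  refine ⟨insert a₀ hTfin.toFinset, ?_, fun F hF hFK => ?_⟩
  · intro a ha
    simp only [Finset.coe_insert, Set.Finite.coe_toFinset] at ha
    rcases ha with rfl | ha
    exacts [ha₀, hTA ha]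
  · rcases F.eq_empty_or_nonempty with rfl | hne
    · exact ⟨a₀, Finset.mem_insert_self _ _, by simp⟩
    · obtain ⟨x, hx⟩ := exists_fin_range_eq hne hF
      obtain ⟨a, ha, hxa⟩ := Set.mem_iUnion₂.1
        (hT fun i _ => hFK (hx ▸ Set.mem_range_self i) : x ∈ _)
      refine ⟨a, Finset.mem_insert_of_mem (hTfin.mem_toFinset.2 ha), ?_⟩
      rw [← hx]
      rintro _ ⟨i, rfl⟩
      exact hxa i trivial

theorem eventually_subset_compactCovering [SigmaCompactSpace X] (F : Finset X) :
    ∀ᶠ n in atTop, F.card ≤ n ∧ (F : Set X) ⊆ compactCovering X n := by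
  refine (eventually_ge_atTop _).and ?_
  have : ∀ᶠ n in atTop, ∀ x ∈ F, x ∈ compactCovering X n := by
    rw [Filter.eventually_all_finset]
    intro x _
    obtain ⟨n, hn⟩ := exists_mem_compactCovering x
    filter_upwards [eventually_ge_atTop n] with m hm
    exact compactCovering_subset X hm hn
  exact this

theorem twoWinsMarkov_omegaCovers [SigmaCompactSpace X] :
    TwoWinsMarkov (omegaCovers X) (omegaCovers X) := by
  classical
  have key : ∀ (𝒰 : Set (Set X)) (n : ℕ), ∃ B : Finset (Set X), 𝒰 ∈ omegaCovers X →
      (B : Set (Set X)) ⊆ 𝒰 ∧ ∀ F : Finset X, F.card ≤ n → (F : Set X) ⊆ compactCovering X n →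
        ∃ U ∈ B, (F : Set X) ⊆ U := by
    intro 𝒰 n
    by_cases h : 𝒰 ∈ omegaCovers X
    · obtain ⟨B, hB, hF⟩ := IsCompact.exists_finset_omega_subfamily
        (isCompact_compactCovering X n) n (V := fun U : 𝒰 => (U : Set X))
        (fun U => h.1 U U.2) (A := Set.univ) (fun F => by
          obtain ⟨U, hU, hFU⟩ := h.2.2.2 F F.finite_toSet
          exact ⟨⟨U, hU⟩, trivial, hFU⟩)
      refine ⟨B.image Subtype.val, fun _ => ⟨?_, fun F h1 h2 => ?_⟩⟩
      · intro U hU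
        obtain ⟨V, -, rfl⟩ := Finset.mem_image.1 (Finset.mem_coe.1 hU)
        exact V.2
      · obtain ⟨U, hU, hFU⟩ := hF F h1 h2
        exact ⟨U, Finset.mem_image_of_mem _ hU, hFU⟩
    · exact ⟨∅, fun h' => absurd h' h⟩
  choose σ hσ using key
  refine ⟨σ, fun 𝒰 h𝒰 n => (hσ 𝒰 n h𝒰).1, fun A hA => ?_⟩
  have hsub : ∀ U ∈ ⋃ n : ℕ, (σ (A n) n : Set (Set X)), ∃ n, U ∈ A n := fun U hU => by
    obtain ⟨n, hn⟩ := Set.mem_iUnion.1 hU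
    exact ⟨n, (hσ (A n) n (hA n)).1 hn⟩
  have hω : ∀ F : Set X, F.Finite → ∃ U ∈ ⋃ n : ℕ, (σ (A n) n : Set (Set X)), F ⊆ U := by
    intro F hF
    obtain ⟨n, hn⟩ := (eventually_subset_compactCovering hF.toFinset).exists
    obtain ⟨U, hU, hFU⟩ := (hσ (A n) n (hA n)).2 _ hn.1 hn.2
    exact ⟨U, Set.mem_iUnion.2 ⟨n, hU⟩, by simpa using hFU⟩
  refine ⟨fun U hU => ?_, ?_, fun hU => ?_, hω⟩
  · obtain ⟨n, hn⟩ := hsub U hU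
    exact (hA n).1 U hn
  · refine Set.eq_univ_of_forall fun x => ?_
    obtain ⟨U, hU, hxU⟩ := hω {x} (Set.finite_singleton x)
    exact ⟨U, hU, hxU rfl⟩
  · obtain ⟨n, hn⟩ := hsub _ hU
    exact (hA n).2.2.1 hn

theorem Dense.exists_finset_Cp_approx {K : Set X} (hK : IsCompact K) (n : ℕ)
    {A : Set (Cp X)} (hA : Dense A) (f : Cp X) {ε : ℝ} (hε : 0 < ε) :
    ∃ B : Finset (Cp X), (B : Set (Cp X)) ⊆ A ∧ ∀ F : Finset X, F.card ≤ n → (F : Set X) ⊆ K →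
      ∃ h ∈ B, ∀ x ∈ F, |h.1 x - f.1 x| < ε :=
  IsCompact.exists_finset_omega_subfamily hK n (V := fun h : Cp X => {x | |h.1 x - f.1 x| < ε})
    (fun h => isOpen_lt (h.2.sub f.2).abs continuous_const)
    fun F => mem_closure_Cp_iff.1 (hA f) F ε hε

/-- One selection per round and target function. Selections made at `f` in infinitely many
rounds accumulate at `f`. -/
theorem exists_selection_Cp (X : Type*) [TopologicalSpace X] [SigmaCompactSpace X] :
    ∃ τ : Cp X → Set (Cp X) → ℕ → Finset (Cp X),
      (∀ f A n, Dense A → (τ f A n : Set (Cp X)) ⊆ A) ∧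
      ∀ f (A : ℕ → Set (Cp X)) (C : Set (Cp X)), (∀ n, Dense (A n)) →
        (∀ n, (τ f (A n) n : Set (Cp X)) ⊆ C) → f ∈ closure C := by
  have key : ∀ (f : Cp X) (A : Set (Cp X)) (n : ℕ), ∃ B : Finset (Cp X), Dense A →
      (B : Set (Cp X)) ⊆ A ∧ ∀ F : Finset X, F.card ≤ n → (F : Set X) ⊆ compactCovering X n →
        ∃ h ∈ B, ∀ x ∈ F, |h.1 x - f.1 x| < 1 / ((n : ℝ) + 1) := by
    intro f A n
    by_cases h : Dense A
    · obtain ⟨B, hB⟩ := Dense.exists_finset_Cp_approx (isCompact_compactCovering X n) n h f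
        (Nat.one_div_pos_of_nat (α := ℝ) (n := n))
      exact ⟨B, fun _ => hB⟩
    · exact ⟨∅, fun h' => absurd h' h⟩
  choose τ hτ using key
  refine ⟨τ, fun f A n hA => (hτ f A n hA).1, fun f A C hA hC => ?_⟩
  rw [mem_closure_Cp_iff]
  intro F ε hε
  have hlim : ∀ᶠ n : ℕ in atTop, 1 / ((n : ℝ) + 1) < ε :=
    tendsto_one_div_add_atTop_nhds_zero_nat.eventually_lt_const hε
  obtain ⟨n, hn, hnε⟩ := ((eventually_subset_compactCovering F).and hlim).exists
  obtain ⟨h, hB, hh⟩ := (hτ f (A n) n (hA n)).2 F hn.1 hn.2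
  exact ⟨h, hC n hB, fun x hx => (hh x hx).trans hnε⟩

theorem twoWinsMarkov_dense_omegaAt [SigmaCompactSpace X] (f : Cp X) :
    TwoWinsMarkov (denseSets (Cp X)) (omegaAt f) := by
  obtain ⟨τ, hτ, hcl⟩ := exists_selection_Cp X
  rcases isEmpty_or_nonempty X with hX | hX
  · refine ⟨fun A n => τ f A n, fun A hA n => hτ f A n hA, fun A hA => ?_⟩
    exact mem_omegaAt_of_dense_of_isEmpty
      (closure_nonempty_iff.1 ⟨f, hcl f A _ hA fun n => Set.subset_iUnion
        (fun n => (τ f (A n) n : Set (Cp X))) n⟩) f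
  -- Selecting from `A \ {f}`, still dense as `C_p(X)` has no isolated points, keeps `f` out of the
  -- union.
  · have hd : ∀ {A : Set (Cp X)}, A ∈ denseSets (Cp X) → Dense (A \ {f}) := fun hA =>
      dense_diff_singleton_Cp hA f
    refine ⟨fun A n => τ f (A \ {f}) n, fun A hA n => (hτ f _ n (hd hA)).trans Set.sdiff_subset,
      fun A hA => Or.inl ⟨hcl f (fun n => A n \ {f}) _ (fun n => hd (hA n)) fun n =>
        Set.subset_iUnion (fun n => (τ f (A n \ {f}) n : Set (Cp X))) n, fun hf => ?_⟩⟩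
    obtain ⟨n, hn⟩ := Set.mem_iUnion.1 hf
    exact (hτ f _ n (hd (hA n)) hn).2 rfl

theorem twoWinsMarkov_dense_dense [SigmaCompactSpace X] [NormalSpace X] [T1Space X]
    [SecondCountableTopology X] :
    TwoWinsMarkov (denseSets (Cp X)) (denseSets (Cp X)) := by
  obtain ⟨τ, hτ, hcl⟩ := exists_selection_Cp X
  have := separableSpace_Cp (X := X)
  have : Nonempty (Cp X) := ⟨⟨fun _ => 0, continuous_const⟩⟩
  let d := TopologicalSpace.denseSeq (Cp X)
  -- Round `Nat.pair j n` plays the `n`-th selection aimed at `d j`, so each target gets infinitely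
  -- many rounds.
  refine ⟨fun A n => τ (d n.unpair.1) A n.unpair.2, fun A hA n => hτ _ A _ hA, fun A hA => ?_⟩
  have hrange : Set.range d ⊆ closure (⋃ n : ℕ, (τ (d n.unpair.1) (A n) n.unpair.2 :
      Set (Cp X))) := by
    rintro _ ⟨j, rfl⟩
    refine hcl (d j) (fun n => A (Nat.pair j n)) _ (fun n => hA _) fun n => ?_
    have := Set.subset_iUnion
      (fun n : ℕ => (τ (d n.unpair.1) (A n) n.unpair.2 : Set (Cp X))) (Nat.pair j n)
    simpa only [Nat.unpair_pair] using this
  exact dense_closure.1 ((TopologicalSpace.denseRange_denseSeq (Cp X)).mono hrange)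

end SigmaCompact

/-! ### From `C_p(X)` to `ω`-covers -/

section Transfer

variable {X : Type*} [TopologicalSpace X]

theorem TwoWins.dense_omegaAt (h : TwoWins (denseSets (Cp X)) (denseSets (Cp X))) (f : Cp X) :
    TwoWins (denseSets (Cp X)) (omegaAt f) := by
  obtain ⟨σ, hσ, hwin⟩ := h
  rcases isEmpty_or_nonempty X with hX | hX
  · refine ⟨σ, hσ, fun A hA => mem_omegaAt_of_dense_of_isEmpty ?_ f⟩
    exact closure_nonempty_iff.1 ⟨f, hwin A hA f⟩
  · have hd : ∀ {A : Set (Cp X)}, A ∈ denseSets (Cp X) → A \ {f} ∈ denseSets (Cp X) :=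
      fun hA => dense_diff_singleton_Cp hA f
    refine ⟨fun n A => σ n fun i => A i \ {f},
      fun n A hA => (hσ n _ fun i => hd (hA i)).trans Set.sdiff_subset,
      fun A hA => Or.inl ⟨hwin (fun n => A n \ {f}) (fun n => hd (hA n)) f, fun hf => ?_⟩⟩
    obtain ⟨n, hn⟩ := Set.mem_iUnion.1 hf
    exact (hσ n (fun i => A i \ {f}) (fun i => hd (hA i)) hn).2 rfl

/-- The functions that are constantly `1` off some member of a family of sets. -/
def oneOff (𝒰 : Set (Set X)) : Set (Cp X) :=
  {h | ∃ U ∈ 𝒰, ∀ x ∉ U, h.1 x = 1}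

/-- A Urysohn function blends `g` on `F` into the constant `1` off some `U ⊇ F`. -/
theorem dense_oneOff [NormalSpace X] [T1Space X] {𝒰 : Set (Set X)} (h𝒰 : 𝒰 ∈ omegaCovers X) :
    Dense (oneOff 𝒰) := by
  intro g
  rw [mem_closure_Cp_iff]
  intro F ε hε
  obtain ⟨U, hU, hFU⟩ := h𝒰.2.2.2 F F.finite_toSet
  obtain ⟨φ, h0, h1, -⟩ := exists_continuous_zero_one_of_isClosed F.finite_toSet.isClosed
    (h𝒰.1 U hU).isClosed_compl (Set.disjoint_compl_right_iff_subset.2 hFU)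
  refine ⟨⟨fun x => φ x + (1 - φ x) * g.1 x,
    φ.continuous.add ((continuous_const.sub φ.continuous).mul g.2)⟩,
    ⟨U, hU, fun x hx => ?_⟩, fun x hx => ?_⟩
  · have : φ x = 1 := h1 hx
    simp [this]
  · have : φ x = 0 := h0 hx
    simpa [this] using hε

theorem TwoWins.omegaCovers_of_Cp [NormalSpace X] [T1Space X]
    (h : TwoWins (denseSets (Cp X)) (omegaAt (⟨fun _ => 0, continuous_const⟩ : Cp X))) :
    TwoWins (omegaCovers X) (omegaCovers X) := by
  classical
  obtain ⟨σ, hσ, hwin⟩ := h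
  have hchoose : ∀ (𝒰 : Set (Set X)) (h : Cp X), ∃ U : Set X, h ∈ oneOff 𝒰 →
      U ∈ 𝒰 ∧ ∀ x ∉ U, h.1 x = 1 := by
    intro 𝒰 h
    by_cases hh : h ∈ oneOff 𝒰
    · obtain ⟨U, hU⟩ := hh
      exact ⟨U, fun _ => hU⟩
    · exact ⟨∅, fun h' => absurd h' hh⟩
  choose u hu using hchoose
  have hsub : ∀ (n : ℕ) (A : Fin (n + 1) → Set (Set X)), (∀ i, A i ∈ omegaCovers X) →
      (σ n (fun i => oneOff (A i)) : Set (Cp X)) ⊆ oneOff (A (Fin.last n)) :=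
    fun n A hA => hσ n _ fun i => dense_oneOff (hA i)
  refine ⟨fun n A => (σ n fun i => oneOff (A i)).image (u (A (Fin.last n))), ?_, ?_⟩
  · intro n A hA U hU
    obtain ⟨h, hh, rfl⟩ := Finset.mem_image.1 (Finset.mem_coe.1 hU)
    exact (hu _ h (hsub n A hA hh)).1
  · intro A hA
    set C : Set (Set X) := ⋃ n : ℕ, (((σ n fun i : Fin (n + 1) => oneOff (A i)).image
      (u (A (Fin.last n : Fin (n + 1)))) : Finset (Set X)) : Set (Set X)) with hC
    have hCA : ∀ U ∈ C, ∃ n, U ∈ A n := by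
      intro U hU
      obtain ⟨n, hn⟩ := Set.mem_iUnion.1 hU
      obtain ⟨h, hh, rfl⟩ := Finset.mem_image.1 (Finset.mem_coe.1 hn)
      exact ⟨n, (hu _ h (hsub n (fun i => A i) (fun i => hA i) hh)).1⟩
    have hcl : (⟨fun _ => 0, continuous_const⟩ : Cp X) ∈
        closure (⋃ n : ℕ, (σ n (fun i : Fin (n + 1) => oneOff (A i)) : Set (Cp X))) := by
      rcases hwin (fun n => oneOff (A n)) (fun n => dense_oneOff (hA n)) with h | h
      · exact h.1
      · rw [h]
        exact subset_closure rfl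
    have hω : ∀ F : Set X, F.Finite → ∃ U ∈ C, F ⊆ U := by
      intro F hF
      -- With tolerance `1`, `h` differs from `1` on `F`, so its chosen set contains `F`.
      obtain ⟨h, hh, hsmall⟩ := mem_closure_Cp_iff.1 hcl hF.toFinset 1 one_pos
      obtain ⟨n, hn⟩ := Set.mem_iUnion.1 hh
      refine ⟨u (A n) h, Set.mem_iUnion.2 ⟨n, Finset.mem_coe.2 (Finset.mem_image.2
        ⟨h, hn, rfl⟩)⟩, fun x hx => ?_⟩
      by_contra hxu
      have h1 := (hu _ h (hsub n (fun i => A i) (fun i => hA i) hn)).2 x hxu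
      have h2 := hsmall x (hF.mem_toFinset.2 hx)
      simp [h1] at h2
    refine ⟨fun U hU => ?_, ?_, fun hU => ?_, hω⟩
    · obtain ⟨n, hn⟩ := hCA U hU
      exact (hA n).1 U hn
    · refine Set.eq_univ_of_forall fun x => ?_
      obtain ⟨U, hU, hxU⟩ := hω {x} (Set.finite_singleton x)
      exact ⟨U, hU, hxU rfl⟩
    · obtain ⟨n, hn⟩ := hCA _ hU
      exact (hA n).2.2.1 hn

end Transfer

/-! ### A winning strategy on `ω`-covers makes the space `σ`-compact -/

section Telgarsky

variable {X : Type*} [TopologicalSpace X]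

/-- Given an open cover of `K`, offer the open sets whose closure lies in finitely many cover
members together with `Kᶜ`. By normality this is an ω-cover unless it contains `X`; the finite
answer to it yields a finite subcover of `K`. -/
theorem isCompact_iInter_closure_sUnion [NormalSpace X] [T1Space X]
    (R : omegaCovers X → Finset (Set X)) (hR : ∀ 𝒰, (R 𝒰 : Set (Set X)) ⊆ 𝒰) :
    IsCompact (⋂ 𝒰, closure (⋃₀ (R 𝒰 : Set (Set X)))) := by
  classical
  set K := ⋂ 𝒰, closure (⋃₀ (R 𝒰 : Set (Set X))) with hKdef
  have hK : IsClosed K := isClosed_iInter fun _ => isClosed_closure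
  refine isCompact_of_finite_subcover fun {ι} V hV hKV => ?_
  let O : Finset ι → Set X := fun t => (⋃ i ∈ t, V i) ∪ Kᶜ
  have hO : ∀ t, IsOpen (O t) := fun t =>
    (isOpen_biUnion fun i _ => hV i).union hK.isOpen_compl
  have hmono : ∀ {s t : Finset ι}, s ⊆ t → O s ⊆ O t := fun hst =>
    Set.union_subset_union_left _ (Set.biUnion_subset_biUnion_left hst)
  have hfinal : ∀ t, K ⊆ O t → K ⊆ ⋃ i ∈ t, V i := fun t ht x hx =>
    (ht hx).resolve_right fun h => h hx
  let 𝒲 : Set (Set X) := {W | IsOpen W ∧ ∃ t, closure W ⊆ O t}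
  by_cases huniv : Set.univ ∈ 𝒲
  · obtain ⟨-, t, ht⟩ := huniv
    exact ⟨t, hfinal t fun x _ => ht (subset_closure trivial)⟩
  have hω : ∀ F : Set X, F.Finite → ∃ W ∈ 𝒲, F ⊆ W := by
    intro F hF
    have hpt : ∀ x : X, ∃ t, x ∈ O t := by
      intro x
      by_cases hx : x ∈ K
      · obtain ⟨i, hi⟩ := Set.mem_iUnion.1 (hKV hx)
        exact ⟨{i}, Or.inl (by simpa using hi)⟩
      · exact ⟨∅, Or.inr hx⟩
    choose t ht using hpt
    have hsub : F ⊆ O (hF.toFinset.biUnion t) := fun x hx =>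
      hmono (Finset.subset_biUnion_of_mem t (hF.mem_toFinset.2 hx)) (ht x)
    obtain ⟨W, hWo, hFW, hW⟩ := normal_exists_closure_subset hF.isClosed (hO _) hsub
    exact ⟨W, ⟨hWo, _, hW⟩, hFW⟩
  have h𝒲 : 𝒲 ∈ omegaCovers X := by
    refine ⟨fun W hW => hW.1, Set.eq_univ_of_forall fun x => ?_, huniv, hω⟩
    obtain ⟨W, hW, hxW⟩ := hω {x} (Set.finite_singleton x)
    exact ⟨W, hW, hxW rfl⟩
  have hex : ∀ W : Set X, ∃ t, W ∈ 𝒲 → closure W ⊆ O t := by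
    intro W
    by_cases hW : W ∈ 𝒲
    · obtain ⟨t, ht⟩ := hW.2
      exact ⟨t, fun _ => ht⟩
    · exact ⟨∅, fun h => absurd h hW⟩
  choose t ht using hex
  refine ⟨(R ⟨𝒲, h𝒲⟩).biUnion t, hfinal _ fun x hx => ?_⟩
  have hx' := Set.mem_iInter.1 hx ⟨𝒲, h𝒲⟩
  rw [Set.sUnion_eq_biUnion, (Finset.finite_toSet _).closure_biUnion] at hx'
  obtain ⟨W, hW, hxW⟩ := Set.mem_iUnion₂.1 hx'
  exact hmono (Finset.subset_biUnion_of_mem t hW) (ht W (hR ⟨𝒲, h𝒲⟩ hW) hxW)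

theorem exists_seq_iInter_eq [SecondCountableTopology X] {ι : Type*} [Nonempty ι] {C : ι → Set X}
    (hC : ∀ i, IsClosed (C i)) : ∃ e : ℕ → ι, ⋂ n, C (e n) ⊆ ⋂ i, C i := by
  obtain ⟨T, hT, hTU⟩ := TopologicalSpace.isOpen_iUnion_countable (fun i => (C i)ᶜ)
    fun i => (hC i).isOpen_compl
  obtain ⟨e, he⟩ := (hT.insert (Classical.arbitrary ι)).exists_eq_range (Set.insert_nonempty _ _)
  refine ⟨e, fun x hx => ?_⟩
  by_contra hxC
  rw [← Set.mem_compl_iff, Set.compl_iInter, ← hTU] at hxC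
  obtain ⟨i, hi, hxi⟩ := Set.mem_iUnion₂.1 hxC
  obtain ⟨n, rfl⟩ : i ∈ Set.range e := he ▸ Set.mem_insert_of_mem _ hi
  exact hxi (Set.mem_iInter.1 hx n)

/-- The play coded by a list of natural numbers, latest move first, when the legal moves offered
at a position are enumerated by `E`. -/
def codedPlay {β : Type*} (E : ℕ → (ℕ → β) → ℕ → β) (b : β) : List ℕ → ℕ → β
  | [] => fun _ => b
  | m :: l => Function.update (codedPlay E b l) l.length (E l.length (codedPlay E b l) m)

/-- The position reached after `k` rounds of choosing codes by `N`. -/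
def codeBranch (N : List ℕ → ℕ) : ℕ → List ℕ
  | 0 => []
  | k + 1 => N (codeBranch N k) :: codeBranch N k

theorem length_codeBranch (N : List ℕ → ℕ) (k : ℕ) : (codeBranch N k).length = k := by
  induction k with
  | zero => rfl
  | succ k ih => simp [codeBranch, ih]

theorem codedPlay_codeBranch {β : Type*} (E : ℕ → (ℕ → β) → ℕ → β) (b : β) (N : List ℕ → ℕ)
    {i k : ℕ} (hik : i < k) :
    codedPlay E b (codeBranch N k) i =
      E i (codedPlay E b (codeBranch N i)) (N (codeBranch N i)) := by
  induction k with
  | zero => exact absurd hik (Nat.not_lt_zero i)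
  | succ k ih =>
    simp only [codeBranch, codedPlay, length_codeBranch]
    rcases Nat.lt_succ_iff_lt_or_eq.1 hik with h | rfl
    · rw [Function.update_of_ne h.ne, ih h]
    · rw [Function.update_self]

theorem TwoWins.sigmaCompactSpace [NormalSpace X] [T1Space X] [SecondCountableTopology X]
    (h : TwoWins (omegaCovers X) (omegaCovers X)) : SigmaCompactSpace X := by
  obtain ⟨σ, hσ, hwin⟩ := h
  -- With no ω-covers the intersection is empty-indexed, hence all of `X`, which is then compact.
  rcases isEmpty_or_nonempty (omegaCovers X) with hΩ | ⟨⟨𝒰₀⟩⟩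
  · have := isCompact_iInter_closure_sUnion (fun _ : omegaCovers X => ∅) fun _ => by simp
    rw [Set.iInter_of_empty] at this
    have : CompactSpace X := ⟨this⟩
    infer_instance
  have : Nonempty (omegaCovers X) := ⟨𝒰₀⟩
  let R : ℕ → (ℕ → omegaCovers X) → Finset (Set X) := fun n A =>
    σ n fun i : Fin (n + 1) => (A i : Set (Set X))
  let C : ℕ → (ℕ → omegaCovers X) → omegaCovers X → Set X := fun n A 𝒰 =>
    closure (⋃₀ (R n (Function.update A n 𝒰) : Set (Set X)))
  have hcompact : ∀ n A, IsCompact (⋂ 𝒰, C n A 𝒰) := fun n A =>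
    isCompact_iInter_closure_sUnion (fun 𝒰 => R n (Function.update A n 𝒰)) fun 𝒰 => by
      have := hσ n (fun i : Fin (n + 1) => (Function.update A n 𝒰 i : Set (Set X)))
        fun i => Subtype.prop _
      simpa using this
  have hE : ∀ n A, ∃ e : ℕ → omegaCovers X, ⋂ m, C n A (e m) ⊆ ⋂ 𝒰, C n A 𝒰 := fun n A =>
    exists_seq_iInter_eq fun _ => isClosed_closure
  choose E hE using hE
  let P := codedPlay E 𝒰₀
  refine SigmaCompactSpace.of_countable (Set.range fun l : List ℕ => ⋂ 𝒰, C l.length (P l) 𝒰)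
    (Set.countable_range _) ?_ ?_
  · rintro _ ⟨l, rfl⟩
    exact hcompact _ _
  by_contra hne
  obtain ⟨x, hx⟩ := (Set.ne_univ_iff_exists_notMem _).1 hne
  have hN : ∀ l : List ℕ, ∃ m, x ∉ C l.length (P l) (E l.length (P l) m) := by
    intro l
    by_contra! hall
    exact hx ⟨_, ⟨l, rfl⟩, hE _ _ (Set.mem_iInter.2 hall)⟩
  -- ONE's counterplay: at each position, a coded move whose answer misses `x`.
  choose N hN using hN
  let A : ℕ → omegaCovers X := fun k => E k (P (codeBranch N k)) (N (codeBranch N k))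
  have hω := hwin (fun k => (A k : Set (Set X))) fun k => (A k).2
  obtain ⟨U, hU, hxU⟩ := Set.mem_sUnion.1 (hω.2.1.symm ▸ Set.mem_univ x)
  obtain ⟨k, hk⟩ := Set.mem_iUnion.1 hU
  have hlast := hN (codeBranch N k)
  rw [length_codeBranch] at hlast
  refine hlast (subset_closure ⟨U, ?_, hxU⟩)
  -- The actual play agrees with the coded one through round `k`, so TWO's real answer is the one
  -- avoiding `x`.
  have heq : (fun i : Fin (k + 1) => (A i : Set (Set X))) = fun i : Fin (k + 1) =>
      (Function.update (P (codeBranch N k)) k (A k) i : Set (Set X)) := by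
    funext i
    have h1 : P (codeBranch N (k + 1)) i = A i := codedPlay_codeBranch E 𝒰₀ N i.2
    rw [← h1]
    simp only [P, codeBranch, codedPlay, length_codeBranch, A]
  change U ∈ (σ k _ : Set (Set X))
  rw [← heq]
  exact hk

end Telgarsky

end SelectionGame

theorem mainTheorem7 (X : Type*) [TopologicalSpace X] [TopologicalSpace.MetrizableSpace X]
    [TopologicalSpace.SeparableSpace X] :
    List.TFAE [
      SelectionGame.TwoWins (SelectionGame.denseSets (SelectionGame.Cp X))
        (SelectionGame.denseSets (SelectionGame.Cp X)),
      ∀ f : SelectionGame.Cp X, SelectionGame.TwoWins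
        (SelectionGame.denseSets (SelectionGame.Cp X)) (SelectionGame.omegaAt f),
      SelectionGame.TwoWins (SelectionGame.omegaCovers X) (SelectionGame.omegaCovers X),
      SelectionGame.TwoWinsMarkov (SelectionGame.denseSets (SelectionGame.Cp X))
        (SelectionGame.denseSets (SelectionGame.Cp X)),
      ∀ f : SelectionGame.Cp X, SelectionGame.TwoWinsMarkov
        (SelectionGame.denseSets (SelectionGame.Cp X)) (SelectionGame.omegaAt f),
      SelectionGame.TwoWinsMarkov (SelectionGame.omegaCovers X) (SelectionGame.omegaCovers X),
      SigmaCompactSpace X] := by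
  have : SecondCountableTopology X := by
    let := TopologicalSpace.metrizableSpaceMetric X
    exact UniformSpace.secondCountable_of_separable X
  tfae_have 4 → 1 := fun h => h.twoWins
  tfae_have 5 → 2 := fun h f => (h f).twoWins
  tfae_have 6 → 3 := fun h => h.twoWins
  tfae_have 1 → 2 := fun h f => h.dense_omegaAt f
  tfae_have 2 → 3 := fun h => SelectionGame.TwoWins.omegaCovers_of_Cp (h _)
  tfae_have 3 → 7 := fun h => h.sigmaCompactSpace
  tfae_have 7 → 4 := fun _ => SelectionGame.twoWinsMarkov_dense_dense
  tfae_have 7 → 5 := fun _ f => SelectionGame.twoWinsMarkov_dense_omegaAt f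
  tfae_have 7 → 6 := fun _ => SelectionGame.twoWinsMarkov_omegaCovers
  tfae_finish
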